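/- An \emph{MV-algebra} is an algebra $(A,\oplus,\neg,0)$ of type $(2,1,0)$ such that, with $1:=\neg 0$, for all $x,y,z\in A$: $x\oplus y=y\oplus x$, $x\oplus(y\oplus z)=(x\oplus y)\oplus z$, $x\oplus 0=x$, $\neg\neg x=x$, $x\oplus 1=1$, and $\neg(\neg x\oplus y)\oplus y=\neg(\neg y\oplus x)\oplus x$. It is \emph{nontrivial} if it has more than one element, and \emph{linearly ordered} if its order, given by $x\le y$ iff $\neg x\oplus y=1$, is total. The standard MV-algebra is the real interval $[0,1]$ with $x\oplus y=\min(1,x+y)$, $\neg x=1-x$ and zero element $0$. Products carry the pointwise operations. The \emph{ultraproduct} of a family $(A_i)_{i\in I}$ of MV-algebras by an ultrafilter $U$ on $I$ is the quotient of $\prod_{i\in I}A_i$ by the congruence $x\sim y\iff\{i\in I: x(i)=y(i)\}\in U$; it is an \emph{ultrapower} of $B$ if all $A_i=B$. An \emph{embedding} is an injective map preserving $\oplus$, $\neg$ and $0$. \textbf{Theorem (Di Nola's representation theorem and variants).} \begin{enumerate} \item Every nontrivial linearly ordered MV-algebra can be embedded into an ultrapower of $[0,1]$. \item Every MV-algebra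 can be embedded into a product of (a possibly empty family of) ultrapowers of $[0,1]$. \item Every nontrivial MV-algebra can be embedded into an ultrapower of the countable power $[0,1]^{\mathbb N}$. \item Every MV-algebra can be embedded into an ultraproduct of finite powers $[0,1]^{n_i}$ of $[0,1]$, with $n_i\in\{0,1,2,\dots\}$. \end{enumerate} -/

import Mathlib

/-- An MV-algebra: an algebra `(A, ⊕, ¬, 0)` of type `(2, 1, 0)`. The one-element algebra is
allowed. -/
class MVAlgebra (A : Type*) where
  oplus : A → A → A
  neg : A → A
  zero : A
  oplus_comm : ∀ x y, oplus x y = oplus y x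
  oplus_assoc : ∀ x y z, oplus x (oplus y z) = oplus (oplus x y) z
  oplus_zero : ∀ x, oplus x zero = x
  neg_neg : ∀ x, neg (neg x) = x
  oplus_one : ∀ x, oplus x (neg zero) = neg zero
  lukasiewicz : ∀ x y, oplus (neg (oplus (neg x) y)) y = oplus (neg (oplus (neg y) x)) x

namespace MVAlgebra

/-- The top element `1 := ¬0`. -/
def one {A : Type*} [MVAlgebra A] : A := neg zero

/-- The natural order: `x ≤ y` iff `¬x ⊕ y = 1`. -/
def le {A : Type*} [MVAlgebra A] (x y : A) : Prop := oplus (neg x) y = one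

/-- `A` is linearly ordered: its natural order is total. -/
def IsLinearlyOrdered (A : Type*) [MVAlgebra A] : Prop := ∀ x y : A, le x y ∨ le y x

/-- `A` embeds into `B`: there is an injective homomorphism from `A` to `B`. -/
def Embeds (A B : Type*) [MVAlgebra A] [MVAlgebra B] : Prop :=
  ∃ f : A → B, Function.Injective f ∧
    (∀ x y, f (oplus x y) = oplus (f x) (f y)) ∧
    (∀ x, f (neg x) = neg (f x)) ∧
    f zero = zero

/-- The standard MV-algebra `[0,1]`, with `x ⊕ y = min 1 (x + y)` and `¬x = 1 - x`. -/
noncomputable instance instUnitInterval : MVAlgebra unitInterval where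
  oplus x y := ⟨min 1 ((x : ℝ) + y), le_min zero_le_one (add_nonneg x.2.1 y.2.1), min_le_left _ _⟩
  neg x := ⟨1 - (x : ℝ), sub_nonneg.2 x.2.2, sub_le_self _ x.2.1⟩
  zero := 0
  oplus_comm x y := by ext; simp [add_comm]
  oplus_assoc x y z := by
    have hx := x.2.1
    have hz := z.2.1
    ext
    simp only
    rcases min_cases 1 ((y : ℝ) + z) with h | h <;> rcases min_cases 1 ((x : ℝ) + y) with h' | h' <;>
      rw [h.1, h'.1]
    · rw [min_eq_left (by linarith), min_eq_left (by linarith)]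
    · rw [min_eq_left (by linarith), min_eq_left (by linarith)]
    · rw [min_eq_left (by linarith), min_eq_left (by linarith)]
    · rw [add_assoc]
  oplus_zero x := by
    ext
    simpa using x.2.2
  neg_neg x := by ext; simp
  oplus_one x := by
    ext
    simpa using x.2.1
  lukasiewicz x y := by
    have hx := x.2.2
    have hy := y.2.2
    ext
    simp only
    rcases le_total (x : ℝ) y with h | h
    · rw [min_eq_left (by linarith : (1 : ℝ) ≤ 1 - x + y),
        min_eq_right (by linarith : 1 - (y : ℝ) + x ≤ 1)]
      congr 1; ring
    · rw [min_eq_left (by linarith : (1 : ℝ) ≤ 1 - y + x),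
        min_eq_right (by linarith : 1 - (x : ℝ) + y ≤ 1)]
      congr 1; ring

/-- Direct products, with pointwise operations. -/
instance instPi {I : Type*} (B : I → Type*) [∀ i, MVAlgebra (B i)] : MVAlgebra (∀ i, B i) where
  oplus x y i := oplus (x i) (y i)
  neg x i := neg (x i)
  zero _ := zero
  oplus_comm _ _ := funext fun _ => oplus_comm _ _
  oplus_assoc _ _ _ := funext fun _ => oplus_assoc _ _ _
  oplus_zero _ := funext fun _ => oplus_zero _
  neg_neg _ := funext fun _ => neg_neg _
  oplus_one _ := funext fun _ => oplus_one _
  lukasiewicz _ _ := funext fun _ => lukasiewicz _ _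

/-- The ultraproduct of the family `B` by the ultrafilter `U`: the quotient of the direct product
by the relation `{i | x i = y i} ∈ U`. -/
def Ultraproduct {I : Type*} (U : Ultrafilter I) (B : I → Type*) : Type _ :=
  Quotient ((U : Filter I).productSetoid B)

/-- The operations of an ultraproduct are those induced from the direct product. -/
instance instUltraproduct {I : Type*} (U : Ultrafilter I) (B : I → Type*)
    [∀ i, MVAlgebra (B i)] : MVAlgebra (Ultraproduct U B) where
  oplus := Quotient.map₂ (oplus : (∀ i, B i) → (∀ i, B i) → ∀ i, B i)
    fun _ _ h _ _ h' => by
      filter_upwards [h, h'] with i hi hi'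
      exact congrArg₂ oplus hi hi'
  neg := Quotient.map (neg : (∀ i, B i) → ∀ i, B i) fun _ _ h => by
    filter_upwards [h] with i hi
    exact congrArg neg hi
  zero := Quotient.mk _ (zero : ∀ i, B i)
  oplus_comm := by
    rintro ⟨x⟩ ⟨y⟩
    exact congrArg (Quotient.mk _) (oplus_comm x y)
  oplus_assoc := by
    rintro ⟨x⟩ ⟨y⟩ ⟨z⟩
    exact congrArg (Quotient.mk _) (oplus_assoc x y z)
  oplus_zero := by
    rintro ⟨x⟩
    exact congrArg (Quotient.mk _) (oplus_zero x)
  neg_neg := by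
    rintro ⟨x⟩
    exact congrArg (Quotient.mk _) (neg_neg x)
  oplus_one := by
    rintro ⟨x⟩
    exact congrArg (Quotient.mk _) (oplus_one x)
  lukasiewicz := by
    rintro ⟨x⟩ ⟨y⟩
    exact congrArg (Quotient.mk _) (lukasiewicz x y)

/-- The ultrapower of `B` by the ultrafilter `U`. -/
abbrev Ultrapower {I : Type*} (U : Ultrafilter I) (B : Type*) : Type _ :=
  Ultraproduct U fun _ => B

end MVAlgebra

universe u

/-! All four parts are compactness statements. If every finite subset `S` of `A` has a map to some
`B S` that preserves the operations on elements of `S` and is injective on `S`, then these maps glue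
to an embedding of `A` into an ultraproduct over the finite subsets (`exists_embeds_ultraproduct`).

For a chain, the local maps into `[0,1]` come from Chang's group: unrolling `A` along `ℤ` gives a
totally ordered abelian group in which `⊕` is addition truncated at the unit `of one`. Only finitely
many positivity conditions matter for a given `S`, and Fourier–Motzkin elimination makes them all
hold under one homomorphism to `ℚ`, which is then normalized at the unit. No completeness theorem or
quantifier elimination is needed.

For general `A`, prime ideals give homomorphisms to chains that separate points. Using one for each
pair of distinct elements of `A` gives the product of ultrapowers. Using only the finitely many
pairs from `S` gives local maps into a finite power of `[0,1]`, hence the last two parts. -/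

/-! ### Rational solutions of linear inequalities valid in an ordered group -/

/-- **Fourier–Motzkin elimination**: a finite system of strict homogeneous integral linear
inequalities that is solvable in an abelian group with a strict positive cone is solvable in `ℚ`. -/
theorem exists_rat_solution {G : Type*} [AddCommGroup G] {Pos : G → Prop} (h0 : ¬ Pos 0)
    (hadd : ∀ x y, Pos x → Pos y → Pos (x + y)) :
    ∀ (n : ℕ) (g : Fin n → G) (P : Finset (Fin n → ℤ)), (∀ p ∈ P, Pos (∑ i, p i • g i)) →
      ∃ t : Fin n → ℚ, ∀ p ∈ P, 0 < ∑ i, (p i : ℚ) * t i := by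
  classical
  have hsmul : ∀ (k : ℤ) (x : G), 0 < k → Pos x → Pos (k • x) := by
    intro k x hk hx
    induction k, (Int.add_one_le_iff.2 hk) using Int.leInduction with
    | base => simpa using hx
    | succ m hm ih =>
      rw [add_smul, one_smul]
      exact hadd _ _ (ih (by omega)) hx
  intro n
  induction n with
  | zero =>
    intro g P hP
    -- With no unknowns, any `p ∈ P` would make the empty sum positive, so `P` is empty.
    exact ⟨0, fun p hp => absurd (by simpa using hP p hp) h0⟩
  | succ n ih =>
    intro g P hP
    let E : Finset (Fin n → ℤ) := (P.filter fun p => p 0 = 0).image Fin.tail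
    -- Each combination has positive weights `p 0` and `-q 0`, so it stays positive in `G`, and the
    -- unknown of index `0` cancels from it.
    let F : Finset (Fin n → ℤ) :=
      ((P.filter fun p => 0 < p 0) ×ˢ (P.filter fun p => p 0 < 0)).image
        fun pq => pq.1 0 • Fin.tail pq.2 - pq.2 0 • Fin.tail pq.1
    obtain ⟨t, ht⟩ := ih (Fin.tail g) (E ∪ F) (by
      intro r hr
      rcases Finset.mem_union.1 hr with hr | hr
      · obtain ⟨p, hp, rfl⟩ := Finset.mem_image.1 hr
        obtain ⟨hp, hp0⟩ := Finset.mem_filter.1 hp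
        have := hP p hp
        rwa [Fin.sum_univ_succ, hp0, zero_smul, zero_add] at this
      · obtain ⟨⟨p, q⟩, hpq, rfl⟩ := Finset.mem_image.1 hr
        simp only [Finset.mem_product, Finset.mem_filter] at hpq
        obtain ⟨⟨hp, hp0⟩, hq, hq0⟩ := hpq
        have h := hadd _ _ (hsmul _ _ hp0 (hP q hq)) (hsmul (-q 0) _ (by omega) (hP p hp))
        convert h using 1
        simp only [Fin.sum_univ_succ, smul_add, Fin.tail, Pi.sub_apply, Pi.smul_apply, sub_smul,
          smul_eq_mul, mul_smul, Finset.sum_sub_distrib, Finset.smul_sum, neg_smul,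
          Finset.sum_neg_distrib]
        rw [smul_comm (p 0) (q 0)]
        abel)
    let v : (Fin (n + 1) → ℤ) → ℚ := fun p => ∑ i, (Fin.tail p i : ℚ) * t i
    -- The inequalities with `p 0 > 0` bound the eliminated unknown from below and those with `p 0 <
    -- 0` from above; the system `F` says exactly that every lower bound is less than every upper
    -- bound.
    obtain ⟨s, hs, hs'⟩ := Order.exists_between_finsets
      ((P.filter fun p => 0 < p 0).image fun p => -v p / p 0)
      ((P.filter fun p => p 0 < 0).image fun p => -v p / p 0) (by
        intro a ha b hb
        obtain ⟨p, hp, rfl⟩ := Finset.mem_image.1 ha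
        obtain ⟨q, hq, rfl⟩ := Finset.mem_image.1 hb
        have h := ht _ (Finset.mem_union_right _ (Finset.mem_image.2
          ⟨(p, q), Finset.mem_product.2 ⟨hp, hq⟩, rfl⟩))
        have hp0 : (0 : ℚ) < p 0 := by exact_mod_cast (Finset.mem_filter.1 hp).2
        have hq0 : (q 0 : ℚ) < 0 := by exact_mod_cast (Finset.mem_filter.1 hq).2
        have h' : 0 < (p 0 : ℚ) * v q - q 0 * v p := by
          convert h using 1
          simp only [v, Pi.sub_apply, Pi.smul_apply, smul_eq_mul, Int.cast_sub, Int.cast_mul,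
            sub_mul, Finset.sum_sub_distrib, Finset.mul_sum, mul_assoc]
        rw [div_lt_iff₀ hp0, div_mul_eq_mul_div, lt_div_iff_of_neg hq0]
        linarith)
    refine ⟨Fin.cons s t, fun p hp => ?_⟩
    rw [Fin.sum_univ_succ]
    simp only [Fin.cons_zero, Fin.cons_succ]
    change 0 < (p 0 : ℚ) * s + v p
    rcases lt_trichotomy (p 0) 0 with h | h | h
    · have := hs' _ (Finset.mem_image_of_mem _ (Finset.mem_filter.2 ⟨hp, h⟩))
      rw [lt_div_iff_of_neg (by exact_mod_cast h)] at this
      linarith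
    · have := ht _ (Finset.mem_union_left _ (Finset.mem_image_of_mem _
        (Finset.mem_filter.2 ⟨hp, h⟩)))
      rw [h, Int.cast_zero, zero_mul, zero_add]
      exact this
    · have := hs _ (Finset.mem_image_of_mem _ (Finset.mem_filter.2 ⟨hp, h⟩))
      rw [div_lt_iff₀ (by exact_mod_cast h)] at this
      linarith

/-- Finitely many positive elements of an abelian group with a strict total positive cone can be
made positive by a homomorphism to `ℚ`. -/
theorem exists_addMonoidHom_pos {G : Type*} [AddCommGroup G] {Pos : G → Prop} (h0 : ¬ Pos 0)
    (hadd : ∀ x y, Pos x → Pos y → Pos (x + y)) (htot : ∀ x, x ≠ 0 → Pos x ∨ Pos (-x))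
    (S : Finset G) (hS : ∀ x ∈ S, Pos x) : ∃ φ : G →+ ℚ, ∀ x ∈ S, 0 < φ x := by
  classical
  have hnsmul : ∀ (k : ℕ) (x : G), Pos x → Pos ((k + 1) • x) := by
    intro k x hx
    induction k with
    | zero => simpa using hx
    | succ k ih => rw [succ_nsmul]; exact hadd _ _ ih hx
  have : IsAddTorsionFree G := by
    refine ⟨fun k hk x y hxy => ?_⟩
    obtain ⟨k, rfl⟩ := Nat.exists_eq_succ_of_ne_zero hk
    by_contra hne
    have hk : (k + 1) • (x - y) = 0 := by rw [smul_sub, sub_eq_zero]; exact hxy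
    rcases htot _ (sub_ne_zero.2 hne) with h | h
    · exact h0 (hk ▸ hnsmul k _ h)
    · have := hnsmul k _ h
      rw [smul_neg, hk, neg_zero] at this
      exact h0 this
  -- Being finitely generated and torsion-free, `H` is free, so the elements of `S` become integer
  -- coordinate vectors.
  let H := Submodule.span ℤ (S : Set G)
  have : Module.Finite ℤ H := Module.Finite.span_of_finite ℤ S.finite_toSet
  let b := Module.finBasis ℤ H
  obtain ⟨t, ht⟩ := exists_rat_solution h0 hadd _ (fun i => (b i : G))
    (S.attach.image fun x : {x // x ∈ S} => ⇑(b.repr ⟨x, Submodule.subset_span x.2⟩)) (by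
      intro p hp
      obtain ⟨x, -, rfl⟩ := Finset.mem_image.1 hp
      have := congrArg H.subtype (b.sum_repr ⟨x, Submodule.subset_span x.2⟩)
      have h := hS x x.2
      convert h using 1
      simpa only [map_sum, map_zsmul, Submodule.subtype_apply] using this)
  let ψ : H →ₗ[ℤ] ℚ := b.constr ℤ t
  -- `ℚ` is divisible, hence injective, so `ψ` extends from `H` to `G`.
  obtain ⟨φ, hφ⟩ := Module.Baer.extension_property_addMonoidHom (Module.Baer.of_divisible ℚ)
    H.subtype.toAddMonoidHom H.injective_subtype ψ.toAddMonoidHom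
  refine ⟨φ, fun x hx => ?_⟩
  have h := ht _ (Finset.mem_image_of_mem _ (Finset.mem_attach S ⟨x, hx⟩))
  have h' : φ x = ψ ⟨x, Submodule.subset_span hx⟩ := DFunLike.congr_fun hφ ⟨x, _⟩
  rw [h', Module.Basis.constr_apply_fintype]
  simpa using h

/-! ### Arithmetic of MV-algebras -/

namespace MVAlgebra

local infixl:65 " ∔ " => oplus
local prefix:max "∼" => neg
local infix:50 " ≼ " => le

/-- The strong conjunction `x ⊙ y = ¬(¬x ⊕ ¬y)`. -/
def odot {A : Type*} [MVAlgebra A] (x y : A) : A := ∼(∼x ∔ ∼y)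

/-- The truncated difference `x ⊖ y = ¬(¬x ⊕ y)`. -/
def tsub {A : Type*} [MVAlgebra A] (x y : A) : A := ∼(∼x ∔ y)

local infixl:70 " ⊚ " => odot
local infixl:65 " ∸ " => tsub

section Order

variable {A : Type*} [MVAlgebra A] {w x y z : A}

theorem neg_injective : Function.Injective (neg : A → A) :=
  Function.LeftInverse.injective neg_neg

theorem neg_zero : ∼(zero : A) = one := rfl

theorem neg_one : ∼(one : A) = zero := neg_neg _

theorem zero_oplus (x : A) : zero ∔ x = x := by rw [oplus_comm, oplus_zero]

theorem oplus_one_eq (x : A) : x ∔ one = one := oplus_one x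

theorem one_oplus (x : A) : one ∔ x = one := by rw [oplus_comm, oplus_one_eq]

theorem oplus_left_comm (x y z : A) : x ∔ (y ∔ z) = y ∔ (x ∔ z) := by
  rw [oplus_assoc, oplus_comm x y, oplus_assoc]

theorem neg_oplus_self (x : A) : ∼x ∔ x = one := by
  have h := lukasiewicz x one
  rw [oplus_one_eq, neg_one, zero_oplus] at h
  exact h.symm

theorem oplus_neg_self (x : A) : x ∔ ∼x = one := by rw [oplus_comm, neg_oplus_self]

theorem le_refl (x : A) : x ≼ x := neg_oplus_self x

theorem le_oplus_right (x y : A) : x ≼ x ∔ y := by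
  rw [le, oplus_assoc, neg_oplus_self, one_oplus]

theorem tsub_oplus_comm (x y : A) : (x ∸ y) ∔ y = (y ∸ x) ∔ x := lukasiewicz x y

theorem tsub_eq_zero : x ∸ y = zero ↔ x ≼ y := by
  rw [tsub, le, ← neg_one, neg_injective.eq_iff]

theorem tsub_oplus_cancel (h : x ≼ y) : (y ∸ x) ∔ x = y := by
  rw [← tsub_oplus_comm, tsub_eq_zero.2 h, zero_oplus]

theorem le_antisymm (h : x ≼ y) (h' : y ≼ x) : x = y := by
  rw [← tsub_oplus_cancel h, tsub_eq_zero.2 h', zero_oplus]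

theorem le_trans (h : x ≼ y) (h' : y ≼ z) : x ≼ z := by
  rw [← tsub_oplus_cancel h', ← tsub_oplus_cancel h, oplus_comm _ x, oplus_left_comm]
  exact le_oplus_right _ _

theorem zero_le (x : A) : (zero : A) ≼ x := one_oplus x

theorem le_one (x : A) : x ≼ one := oplus_one_eq _

theorem le_zero : x ≼ zero ↔ x = zero :=
  ⟨fun h => le_antisymm h (zero_le x), fun h => h ▸ le_refl _⟩

theorem oplus_le_oplus_left (h : x ≼ y) (z : A) : z ∔ x ≼ z ∔ y := by
  rw [← tsub_oplus_cancel h, oplus_comm (y ∸ x), oplus_assoc]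
  exact le_oplus_right _ _

theorem oplus_le_oplus_right (h : x ≼ y) (z : A) : x ∔ z ≼ y ∔ z := by
  rw [oplus_comm x, oplus_comm y]
  exact oplus_le_oplus_left h z

theorem neg_le_neg (h : x ≼ y) : ∼y ≼ ∼x := by
  rw [le, neg_neg, oplus_comm]
  exact h

theorem tsub_le_iff : x ∸ y ≼ z ↔ x ≼ y ∔ z := by
  rw [le, le, tsub, neg_neg, oplus_assoc]

theorem neg_tsub_neg (x y : A) : ∼x ∸ ∼y = y ∸ x := by
  rw [tsub, tsub, neg_neg, oplus_comm]

theorem tsub_le_self (x y : A) : x ∸ y ≼ x :=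
  tsub_le_iff.2 <| by rw [oplus_comm]; exact le_oplus_right _ _

theorem le_oplus_tsub (x y : A) : x ≼ y ∔ (x ∸ y) := tsub_le_iff.1 (le_refl _)

theorem tsub_le_tsub_right (h : x ≼ y) (z : A) : x ∸ z ≼ y ∸ z :=
  tsub_le_iff.2 (le_trans h (le_oplus_tsub y z))

theorem tsub_oplus_le (hx : x ≼ z) (hy : y ≼ z) : (x ∸ y) ∔ y ≼ z := by
  rw [← tsub_oplus_cancel hy]
  exact oplus_le_oplus_right (tsub_le_tsub_right hx y) y

theorem oplus_eq_zero_left (h : x ∔ y = zero) : x = zero :=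
  le_zero.1 (h ▸ le_oplus_right x y)

theorem odot_comm (x y : A) : x ⊚ y = y ⊚ x := by rw [odot, odot, oplus_comm]

theorem odot_assoc (x y z : A) : x ⊚ (y ⊚ z) = x ⊚ y ⊚ z := by
  simp only [odot, neg_neg, oplus_assoc]

theorem neg_odot (x y : A) : ∼(x ⊚ y) = ∼x ∔ ∼y := neg_neg _

theorem neg_oplus (x y : A) : ∼(x ∔ y) = ∼x ⊚ ∼y := by rw [odot, neg_neg, neg_neg]

theorem tsub_eq_odot (x y : A) : x ∸ y = x ⊚ ∼y := by rw [odot, tsub, neg_neg]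

theorem odot_eq_zero : x ⊚ y = zero ↔ x ≼ ∼y := by
  rw [odot, le, ← neg_one, neg_injective.eq_iff]

theorem one_odot (x : A) : one ⊚ x = x := by rw [odot, neg_one, zero_oplus, neg_neg]

theorem odot_one (x : A) : x ⊚ one = x := by rw [odot_comm, one_odot]

theorem odot_ne_one (h : x ≠ one) (y : A) : x ⊚ y ≠ one := fun h' => h <| by
  have := oplus_eq_zero_left (neg_injective (h' : ∼(∼x ∔ ∼y) = ∼zero))
  rw [← neg_neg x, this, neg_zero]

theorem oplus_eq_one : x ∔ y = one ↔ ∼x ≼ y := by rw [le, neg_neg]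

theorem tsub_neg_oplus (h : y ≼ x) : x ⊚ (∼x ∔ y) = y := by
  have h' := tsub_oplus_cancel (neg_le_neg h)
  rw [tsub, neg_neg] at h'
  rw [odot, oplus_comm (∼x), oplus_comm (∼x), h', neg_neg]

/-- The hypotheses give `x = ¬y ⊙ (x ⊕ y)` and `z = ¬y ⊙ (y ⊕ z)`, so both sides equal `(x ⊕ y) ⊙ ¬y
⊙ (y ⊕ z)`. This lemma and the next two are the carry cases of associativity in the Chang group. -/
theorem oplus_odot_eq_odot_oplus (h : x ⊚ y = zero) (h' : y ⊚ z = zero) :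
    (x ∔ y) ⊚ z = x ⊚ (y ∔ z) := by
  have h₁ : ∼y ⊚ (x ∔ y) = x := by
    have := tsub_neg_oplus (odot_eq_zero.1 h)
    rwa [neg_neg, oplus_comm] at this
  have h₂ : ∼y ⊚ (y ∔ z) = z := by
    have := tsub_neg_oplus (odot_eq_zero.1 (odot_comm y z ▸ h'))
    rwa [neg_neg] at this
  conv_lhs => rw [← h₂]
  conv_rhs => rw [← h₁]
  rw [odot_assoc, odot_comm (x ∔ y)]

/-- Put `w = x ⊙ y ⊕ z`. As `z ≤ ¬y`, one gets `w ≤ x`, so `w = x ⊙ (¬x ⊕ w)`; and `¬x ⊕ x ⊙ y = y`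
turns `¬x ⊕ w` into `y ⊕ z`. -/
theorem odot_oplus_eq_odot_oplus (h : x ∔ y = one) (h' : y ⊚ z = zero) :
    x ⊚ y ∔ z = x ⊚ (y ∔ z) := by
  have h₁ : x ⊚ y ∔ ∼x = y := by
    have := tsub_oplus_cancel (oplus_eq_one.1 h)
    rwa [tsub_eq_odot, neg_neg, odot_comm] at this
  have h₂ : x ⊚ y ∔ ∼y = x := by
    have := tsub_oplus_cancel (oplus_eq_one.1 (oplus_comm x y ▸ h))
    rwa [tsub_eq_odot, neg_neg] at this
  have h₃ : x ⊚ y ∔ z ≼ x := by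
    have := oplus_le_oplus_left (odot_eq_zero.1 (odot_comm y z ▸ h')) (x ⊚ y)
    rwa [h₂] at this
  have h₄ := tsub_neg_oplus h₃
  rwa [oplus_assoc, oplus_comm (∼x), h₁, eq_comm] at h₄

theorem odot_oplus_eq_oplus_odot (h : x ∔ y = one) (h' : y ∔ z = one) :
    x ⊚ y ∔ z = x ∔ y ⊚ z := by
  apply neg_injective
  rw [neg_oplus, neg_oplus, neg_odot, neg_odot]
  apply oplus_odot_eq_odot_oplus
  · rw [← neg_oplus, h, neg_one]
  · rw [← neg_oplus, h', neg_one]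

/-- Adding `w` to the infimum `m` of `x` and `y` stays below both, hence below `m`; since `w ≤ ¬m`,
nothing is truncated in `m ⊕ w`, and `w` must vanish. This disjointness of `x ⊖ y` and `y ⊖ x` is
what makes quotients by maximal omitting ideals linear. -/
theorem eq_zero_of_le_tsub (h : w ≼ x ∸ y) (h' : w ≼ y ∸ x) : w = zero := by
  -- `m` is the infimum of `x` and `y`
  obtain ⟨m, hm⟩ : ∃ m, m = ∼((∼x ∸ ∼y) ∔ ∼y) := ⟨_, rfl⟩
  have key : ∀ {a b : A}, w ≼ a ∸ b → ∼((∼a ∸ ∼b) ∔ ∼b) ∔ w ≼ a := by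
    intro a b hab
    have h₁ : ∼((∼a ∸ ∼b) ∔ ∼b) = a ∸ (a ∸ b) := by
      rw [tsub_oplus_comm, tsub, tsub, tsub, neg_neg, oplus_comm b, oplus_comm _ (∼a)]
    rw [h₁]
    have := oplus_le_oplus_left hab (a ∸ (a ∸ b))
    rwa [tsub_oplus_cancel (tsub_le_self a b)] at this
  have hx : m ∔ w ≼ x := hm ▸ key h
  have hy : m ∔ w ≼ y := by
    rw [hm, tsub_oplus_comm]
    exact key h'
  have hle : m ∔ w ≼ m := by
    have := neg_le_neg (tsub_oplus_le (neg_le_neg hx) (neg_le_neg hy))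
    rwa [neg_neg, ← hm] at this
  have hw : w ≼ ∼m := by
    refine le_trans h ?_
    rw [← neg_tsub_neg, hm, neg_neg, oplus_comm]
    exact le_trans (tsub_le_self _ _) (le_oplus_right _ _)
  have := tsub_neg_oplus hw
  rw [neg_neg] at this
  rw [← this, odot_comm, odot_eq_zero, neg_neg]
  exact hle

end Order

/-! ### The Chang group of an MV-chain -/

section Chang

variable {A : Type*} [MVAlgebra A]

theorem one_ne_zero [Nontrivial A] : (one : A) ≠ zero := by
  intro h
  obtain ⟨x, y, hxy⟩ := exists_pair_ne A
  refine hxy (le_antisymm ?_ ?_) <;>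
  · refine le_trans (le_one _) ?_
    rw [h]
    exact zero_le _

/-- By totality `x` and `¬y` are comparable. Associativity in the Chang group uses linearity only
through this fact. -/
theorem IsLinearlyOrdered.odot_eq_zero (hA : IsLinearlyOrdered A) {x y : A} (h : x ∔ y ≠ one) :
    x ⊚ y = zero := by
  rcases hA x ∼y with h' | h'
  · exact MVAlgebra.odot_eq_zero.2 h'
  · exact absurd (by rw [oplus_comm]; exact oplus_eq_one.2 h') h

variable (A) in
/-- The underlying set `ℤ × (A \ {1})` of the Chang group of the MV-chain `A`: integer parts and
fractional parts. -/
@[ext]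
structure ChangGroup where
  int : ℤ
  frac : A
  frac_ne : frac ≠ one

namespace ChangGroup

open Classical in
/-- Addition with carry. -/
noncomputable instance : Add (ChangGroup A) where
  add x y :=
    if h : x.frac ∔ y.frac = one then ⟨x.int + y.int + 1, x.frac ⊚ y.frac, odot_ne_one x.frac_ne _⟩
    else ⟨x.int + y.int, x.frac ∔ y.frac, h⟩

theorem add_of_eq_one {x y : ChangGroup A} (h : x.frac ∔ y.frac = one) :
    x + y = ⟨x.int + y.int + 1, x.frac ⊚ y.frac, odot_ne_one x.frac_ne _⟩ := dif_pos h

theorem add_of_ne_one {x y : ChangGroup A} (h : x.frac ∔ y.frac ≠ one) :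
    x + y = ⟨x.int + y.int, x.frac ∔ y.frac, h⟩ := dif_neg h

instance [Nontrivial A] : Zero (ChangGroup A) := ⟨⟨0, zero, one_ne_zero.symm⟩⟩

theorem int_zero [Nontrivial A] : (0 : ChangGroup A).int = 0 := rfl

theorem frac_zero [Nontrivial A] : (0 : ChangGroup A).frac = zero := rfl

open Classical in
noncomputable instance [Nontrivial A] : Neg (ChangGroup A) where
  neg x :=
    if h : x.frac = zero then ⟨-x.int, zero, one_ne_zero.symm⟩
    else ⟨-x.int - 1, ∼x.frac, fun h' => h (neg_injective h')⟩

theorem neg_of_eq_zero [Nontrivial A] {x : ChangGroup A} (h : x.frac = zero) :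
    -x = ⟨-x.int, zero, one_ne_zero.symm⟩ := dif_pos h

theorem neg_of_ne_zero [Nontrivial A] {x : ChangGroup A} (h : x.frac ≠ zero) :
    -x = ⟨-x.int - 1, ∼x.frac, fun h' => h (neg_injective h')⟩ := dif_neg h

protected theorem add_comm (x y : ChangGroup A) : x + y = y + x := by
  by_cases h : x.frac ∔ y.frac = one
  · rw [add_of_eq_one h, add_of_eq_one (by rw [oplus_comm, h])]
    simp only [add_comm x.int, odot_comm x.frac]
  · rw [add_of_ne_one h, add_of_ne_one (by rwa [oplus_comm])]
    simp only [add_comm x.int, oplus_comm x.frac]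

protected theorem zero_add [Nontrivial A] (x : ChangGroup A) : 0 + x = x := by
  have h : (0 : ChangGroup A).frac ∔ x.frac ≠ one := by
    rw [frac_zero, zero_oplus]
    exact x.frac_ne
  rw [add_of_ne_one h]
  ext
  · simp [int_zero]
  · simp [frac_zero, zero_oplus]

protected theorem neg_add_cancel [Nontrivial A] (x : ChangGroup A) : -x + x = 0 := by
  by_cases h : x.frac = zero
  · rw [neg_of_eq_zero h, add_of_ne_one (by simpa only [zero_oplus] using x.frac_ne)]
    ext
    · simp [int_zero]
    · simp [frac_zero, zero_oplus, h]
  · rw [neg_of_ne_zero h, add_of_eq_one (neg_oplus_self _)]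
    ext
    · simp only [int_zero]; ring
    · simp only [frac_zero]
      exact MVAlgebra.odot_eq_zero.2 (le_refl _)

/-- The element `⟨m, a⟩` stands for `m + a`. If exactly one of the two inner sums carries, both
bracketings carry exactly once; otherwise their outer sums carry simultaneously. -/
protected theorem add_assoc (hA : IsLinearlyOrdered A) (x y z : ChangGroup A) :
    x + y + z = x + (y + z) := by
  by_cases h : x.frac ∔ y.frac = one <;> by_cases h' : y.frac ∔ z.frac = one
  · rw [add_of_eq_one h, add_of_eq_one h']
    have key := odot_oplus_eq_oplus_odot h h'
    by_cases h'' : x.frac ⊚ y.frac ∔ z.frac = one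
    · rw [add_of_eq_one h'', add_of_eq_one (key ▸ h'')]
      ext
      · simp only; ring
      · exact (odot_assoc _ _ _).symm
    · rw [add_of_ne_one h'', add_of_ne_one (key ▸ h'')]
      ext
      · simp only; ring
      · exact key
  · have key := odot_oplus_eq_odot_oplus h (hA.odot_eq_zero h')
    rw [add_of_eq_one h, add_of_ne_one h',
      add_of_ne_one (by simp only [key]; exact odot_ne_one x.frac_ne _),
      add_of_eq_one (by simp only [oplus_assoc, h, one_oplus])]
    ext
    · simp only; ring
    · exact key
  · have key := odot_oplus_eq_odot_oplus (oplus_comm y.frac z.frac ▸ h')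
      (odot_comm x.frac y.frac ▸ hA.odot_eq_zero h)
    rw [odot_comm z.frac, odot_comm z.frac, oplus_comm _ x.frac, oplus_comm _ x.frac] at key
    rw [add_of_ne_one h, add_of_eq_one h',
      add_of_eq_one (by simp only [← oplus_assoc, h', oplus_one_eq]),
      add_of_ne_one (by simp only [key]; rw [odot_comm]; exact odot_ne_one z.frac_ne _)]
    ext
    · simp only; ring
    · exact key.symm
  · rw [add_of_ne_one h, add_of_ne_one h']
    have key := oplus_odot_eq_odot_oplus (hA.odot_eq_zero h) (hA.odot_eq_zero h')
    by_cases h'' : x.frac ∔ y.frac ∔ z.frac = one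
    · rw [add_of_eq_one h'', add_of_eq_one (oplus_assoc x.frac _ _ ▸ h'')]
      ext
      · simp only; ring
      · exact key
    · rw [add_of_ne_one h'', add_of_ne_one (oplus_assoc x.frac _ _ ▸ h'')]
      ext
      · simp only; ring
      · exact (oplus_assoc _ _ _).symm

noncomputable instance [Nontrivial A] [hA : Fact (IsLinearlyOrdered A)] :
    AddCommGroup (ChangGroup A) where
  add_assoc := ChangGroup.add_assoc hA.out
  zero_add := ChangGroup.zero_add
  add_zero x := by rw [ChangGroup.add_comm, ChangGroup.zero_add]
  add_comm := ChangGroup.add_comm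
  neg_add_cancel := ChangGroup.neg_add_cancel
  nsmul := nsmulRec
  zsmul := zsmulRec

/-- The strict positive cone. -/
def Pos (x : ChangGroup A) : Prop := 0 < x.int ∨ x.int = 0 ∧ x.frac ≠ zero

theorem not_pos_zero [Nontrivial A] : ¬ Pos (0 : ChangGroup A) := by
  simp [Pos, int_zero, frac_zero]

theorem Pos.add {x y : ChangGroup A} (hx : Pos x) (hy : Pos y) : Pos (x + y) := by
  have hx' : 0 ≤ x.int := by rcases hx with h | h <;> omega
  have hy' : 0 ≤ y.int := by rcases hy with h | h <;> omega
  by_cases h : x.frac ∔ y.frac = one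
  · rw [add_of_eq_one h]
    left
    simp only
    omega
  · rw [add_of_ne_one h]
    rcases hx with hx | hx
    · left
      simp only
      omega
    rcases hy with hy | hy
    · left
      simp only
      omega
    · exact Or.inr ⟨by simp only; omega, fun h0 => hx.2 (oplus_eq_zero_left h0)⟩

theorem pos_or_pos_neg [Nontrivial A] (x : ChangGroup A) (hx : x ≠ 0) : Pos x ∨ Pos (-x) := by
  by_cases h : x.frac = zero
  · have : x.int ≠ 0 := fun h' => hx (ChangGroup.ext h' h)
    rw [neg_of_eq_zero h]
    rcases lt_or_gt_of_ne this with h' | h'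
    · exact Or.inr (Or.inl (by simp only; omega))
    · exact Or.inl (Or.inl h')
  · rw [neg_of_ne_zero h]
    rcases lt_trichotomy x.int (-1) with h' | h' | h'
    · exact Or.inr (Or.inl (by simp only; omega))
    · exact Or.inr (Or.inr ⟨by simp only; omega, fun h0 => x.frac_ne
        (neg_injective (h0.trans neg_one.symm))⟩)
    · rcases (show 0 ≤ x.int by omega).lt_or_eq with h'' | h''
      · exact Or.inl (Or.inl h'')
      · exact Or.inl (Or.inr ⟨h''.symm, h⟩)

open Classical in
/-- The canonical map of an MV-chain to its Chang group. -/
noncomputable def of [Nontrivial A] (a : A) : ChangGroup A :=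
  if h : a = one then ⟨1, zero, one_ne_zero.symm⟩ else ⟨0, a, h⟩

variable [Nontrivial A]

theorem of_one : of (one : A) = ⟨1, zero, one_ne_zero.symm⟩ := dif_pos rfl

theorem of_of_ne_one {a : A} (h : a ≠ one) : of a = ⟨0, a, h⟩ := dif_neg h

theorem of_zero : of (zero : A) = 0 := of_of_ne_one _

theorem pos_of {a : A} (h : a ≠ zero) : Pos (of a) := by
  by_cases h' : a = one
  · rw [h', of_one]
    exact Or.inl one_pos
  · rw [of_of_ne_one h']
    exact Or.inr ⟨rfl, h⟩

variable [hA : Fact (IsLinearlyOrdered A)]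

/-- The condition `a ⊙ b = 0` says that `a ⊕ b` is an untruncated sum. -/
theorem of_add_of_of_odot_eq_zero {a b : A} (h : a ⊚ b = zero) : of a + of b = of (a ∔ b) := by
  by_cases ha : a = one
  · rw [ha, one_odot] at h
    rw [ha, h, of_zero, add_zero, oplus_zero]
  by_cases hb : b = one
  · rw [hb, odot_one] at h
    rw [hb, h, of_zero, zero_add, zero_oplus]
  rw [of_of_ne_one ha, of_of_ne_one hb]
  by_cases hab : a ∔ b = one
  · rw [add_of_eq_one hab, hab, of_one]
    ext
    · simp
    · exact h
  · rw [add_of_ne_one hab, of_of_ne_one hab]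
    ext
    · simp
    · rfl

theorem of_add_of_neg (a : A) : of a + of ∼a = of one := by
  rw [of_add_of_of_odot_eq_zero, oplus_neg_self]
  rw [odot_eq_zero, neg_neg]
  exact le_refl _

/-- The overflowing case follows from the untruncated one applied to `¬a` and `¬b`, since `of` turns
`¬` into subtraction from the unit. -/
theorem of_add_of_of_oplus_eq_one {a b : A} (h : a ∔ b = one) :
    of a + of b = of one + of (a ⊚ b) := by
  have h' : ∼a ⊚ ∼b = zero := by rw [← neg_oplus, h, neg_one]
  have := of_add_of_of_odot_eq_zero h'
  rw [← neg_odot] at this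
  have h₁ := of_add_of_neg a
  have h₂ := of_add_of_neg b
  have h₃ := of_add_of_neg (a ⊚ b)
  rw [← this] at h₃
  have h₄ : of a + of b + (of ∼a + of ∼b) = of one + of (a ⊚ b) + (of ∼a + of ∼b) := by
    rw [add_add_add_comm, h₁, h₂, add_assoc (of one), h₃]
  exact add_right_cancel h₄

end ChangGroup

end Chang

/-! ### Partial homomorphisms and gluing by an ultraproduct -/

/-- The map `f` preserves the operations on elements of `S`. -/
structure IsHomOn {A B : Type*} [MVAlgebra A] [MVAlgebra B] (S : Set A) (f : A → B) : Prop where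
  map_oplus : ∀ x ∈ S, ∀ y ∈ S, f (x ∔ y) = f x ∔ f y
  map_neg : ∀ x ∈ S, f ∼x = ∼(f x)
  map_zero : f zero = zero

theorem IsHomOn.comp {A B C : Type*} [MVAlgebra A] [MVAlgebra B] [MVAlgebra C] {S : Set A}
    {T : Set B} {g : B → C} {f : A → B} (hg : IsHomOn T g) (hf : IsHomOn S f)
    (h : Set.MapsTo f S T) : IsHomOn S (g ∘ f) where
  map_oplus x hx y hy := by
    simp only [Function.comp, hf.map_oplus x hx y hy, hg.map_oplus _ (h hx) _ (h hy)]
  map_neg x hx := by simp only [Function.comp, hf.map_neg x hx, hg.map_neg _ (h hx)]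
  map_zero := by simp only [Function.comp, hf.map_zero, hg.map_zero]

theorem IsHomOn.mono {A B : Type*} [MVAlgebra A] [MVAlgebra B] {S T : Set A} {f : A → B}
    (hf : IsHomOn T f) (h : S ⊆ T) : IsHomOn S f where
  map_oplus x hx y hy := hf.map_oplus x (h hx) y (h hy)
  map_neg x hx := hf.map_neg x (h hx)
  map_zero := hf.map_zero

theorem IsHomOn.pi {A I : Type*} {B : I → Type*} [MVAlgebra A] [∀ i, MVAlgebra (B i)] {S : Set A}
    {f : ∀ i, A → B i} (hf : ∀ i, IsHomOn S (f i)) : IsHomOn S fun a i => f i a where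
  map_oplus x hx y hy := funext fun i => (hf i).map_oplus x hx y hy
  map_neg x hx := funext fun i => (hf i).map_neg x hx
  map_zero := funext fun i => (hf i).map_zero

theorem embeds_iff {A B : Type*} [MVAlgebra A] [MVAlgebra B] :
    Embeds A B ↔ ∃ f : A → B, Function.Injective f ∧ IsHomOn Set.univ f :=
  ⟨fun ⟨f, hf, h, h', h''⟩ => ⟨f, hf, fun x _ y _ => h x y, fun x _ => h' x, h''⟩,
    fun ⟨f, hf, h⟩ => ⟨f, hf, fun x y => h.map_oplus x trivial y trivial,
      fun x => h.map_neg x trivial, h.map_zero⟩⟩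

/-- An MV-algebra with partial embeddings into the `B S`, defined on all finite subsets `S`, embeds
into an ultraproduct of the `B S`. -/
theorem exists_embeds_ultraproduct {A : Type u} [MVAlgebra A] (B : Finset A → Type*)
    [∀ S, MVAlgebra (B S)] (f : ∀ S, A → B S) (hf : ∀ S : Finset A, IsHomOn (S : Set A) (f S))
    (hinj : ∀ S : Finset A, Set.InjOn (f S) S) :
    ∃ U : Ultrafilter (Finset A), Embeds A (Ultraproduct U B) := by
  classical
  -- Refining `atTop` puts every cone `{T | S ⊆ T}` in `U`, so any condition on finitely many
  -- elements of `A` holds almost everywhere.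
  let U : Ultrafilter (Finset A) := Ultrafilter.of Filter.atTop
  have hU : ∀ S : Finset A, ∀ᶠ T in (U : Filter (Finset A)), S ⊆ T := fun S =>
    Ultrafilter.of_le _ (Filter.eventually_ge_atTop S)
  refine ⟨U, embeds_iff.2 ⟨fun a => Quotient.mk _ fun S => f S a, ?_, ?_, ?_, ?_⟩⟩
  · intro x y hxy
    obtain ⟨S, hS, hS'⟩ := ((hU {x, y}).and (Quotient.exact hxy)).exists
    exact hinj S (hS (by simp)) (hS (by simp)) hS'
  · intro x _ y _
    refine Quotient.sound ?_
    filter_upwards [hU {x, y}] with S hS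
    exact (hf S).map_oplus x (hS (by simp)) y (hS (by simp))
  · intro x _
    refine Quotient.sound ?_
    filter_upwards [hU {x}] with S hS
    exact (hf S).map_neg x (hS (by simp))
  · exact congrArg (Quotient.mk _) (funext fun S => (hf S).map_zero)

/-! ### Local embeddings of chains into the unit interval -/

open ChangGroup in
/-- Every finite subset of a nontrivial MV-chain embeds, as a partial algebra, into `[0,1]`. -/
theorem IsLinearlyOrdered.exists_isHomOn_injOn {A : Type*} [MVAlgebra A] [Nontrivial A]
    (hA : IsLinearlyOrdered A) (S : Finset A) :
    ∃ f : A → unitInterval, IsHomOn (S : Set A) f ∧ Set.InjOn f S := by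
  classical
  have : Fact (IsLinearlyOrdered A) := ⟨hA⟩
  -- These are the elements whose values need control: `x ⊕ y` must have value at most `1`, `x ⊙ y`
  -- nonnegative value, and nonzero `x ⊖ y` positive value for injectivity. Positivity is also
  -- requested on the negations of `V`, which gives the upper bounds by `1`.
  let V : Finset A := insert one (S ∪ Finset.image₂ oplus S S ∪ Finset.image₂ odot S S ∪
    Finset.image₂ tsub S S)
  have hV1 : one ∈ V := by simp [V]
  have hVS : ∀ x ∈ S, x ∈ V := fun x hx => by simp [V, hx]
  have hVo : ∀ x ∈ S, ∀ y ∈ S, x ∔ y ∈ V := fun x hx y hy => by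
    simp only [V, Finset.mem_insert, Finset.mem_union]
    exact Or.inr (Or.inl (Or.inl (Or.inr (Finset.mem_image₂_of_mem hx hy))))
  have hVm : ∀ x ∈ S, ∀ y ∈ S, x ⊚ y ∈ V := fun x hx y hy => by
    simp only [V, Finset.mem_insert, Finset.mem_union]
    exact Or.inr (Or.inl (Or.inr (Finset.mem_image₂_of_mem hx hy)))
  have hVt : ∀ x ∈ S, ∀ y ∈ S, x ∸ y ∈ V := fun x hx y hy => by
    simp only [V, Finset.mem_insert, Finset.mem_union]
    exact Or.inr (Or.inr (Finset.mem_image₂_of_mem hx hy))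
  obtain ⟨φ, hφ⟩ := exists_addMonoidHom_pos (Pos := Pos) (not_pos_zero (A := A))
    (fun _ _ => Pos.add) pos_or_pos_neg
    (((V ∪ V.image neg).filter fun x => x ≠ zero).image of) (by
      intro x hx
      obtain ⟨a, ha, rfl⟩ := Finset.mem_image.1 hx
      exact pos_of (Finset.mem_filter.1 ha).2)
  have hpos : ∀ a ∈ V ∪ V.image neg, a ≠ zero → 0 < φ (of a) := fun a ha h0 =>
    hφ _ (Finset.mem_image_of_mem _ (Finset.mem_filter.2 ⟨ha, h0⟩))
  have hnonneg : ∀ a ∈ V ∪ V.image neg, 0 ≤ φ (of a) := by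
    intro a ha
    by_cases h : a = zero
    · rw [h, of_zero, map_zero]
    · exact (hpos a ha h).le
  have h1 : 0 < φ (of one) := hpos _ (Finset.mem_union_left _ hV1) one_ne_zero
  let g : A → ℝ := fun a => ((φ (of a) / φ (of one) : ℚ) : ℝ)
  have g_one : g one = 1 := by simp [g, h1.ne']
  have g_zero : g zero = 0 := by simp [g, of_zero]
  have g_neg : ∀ a, g ∼a = 1 - g a := by
    intro a
    rw [← g_one]
    simp only [g, ← of_add_of_neg a, map_add]
    push_cast
    ring
  have g_oplus : ∀ a b, a ⊚ b = zero → g (a ∔ b) = g a + g b := by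
    intro a b h
    simp only [g, ← of_add_of_of_odot_eq_zero h, map_add]
    push_cast
    ring
  have g_odot : ∀ a b, a ∔ b = one → g a + g b = 1 + g (a ⊚ b) := by
    intro a b h
    rw [← g_one]
    have := congrArg φ (of_add_of_of_oplus_eq_one h)
    rw [map_add, map_add] at this
    simp only [g]
    rw [← Rat.cast_add, ← Rat.cast_add, ← add_div, ← add_div, this]
  have g_nonneg : ∀ a ∈ V, 0 ≤ g a := fun a ha =>
    Rat.cast_nonneg.2 (div_nonneg (hnonneg a (Finset.mem_union_left _ ha)) h1.le)
  have g_pos : ∀ a ∈ V, a ≠ zero → 0 < g a := fun a ha h0 =>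
    Rat.cast_pos.2 (div_pos (hpos a (Finset.mem_union_left _ ha) h0) h1)
  have g_le_one : ∀ a ∈ V, g a ≤ 1 := by
    intro a ha
    have : 0 ≤ g ∼a := Rat.cast_nonneg.2 (div_nonneg
      (hnonneg _ (Finset.mem_union_right _ (Finset.mem_image_of_mem _ ha))) h1.le)
    rw [g_neg] at this
    linarith
  -- Clamping only makes `f` total; `g` already takes values in `[0,1]` on `V`.
  let f : A → unitInterval := fun a => Set.projIcc 0 1 zero_le_one (g a)
  have hf : ∀ a, 0 ≤ g a → g a ≤ 1 → (f a : ℝ) = g a := fun a h h' => by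
    simp only [f, Set.projIcc_of_mem zero_le_one (Set.mem_Icc.2 ⟨h, h'⟩)]
  have hfV : ∀ a ∈ V, (f a : ℝ) = g a := fun a ha => hf a (g_nonneg a ha) (g_le_one a ha)
  refine ⟨f, ⟨?_, ?_, ?_⟩, ?_⟩
  · intro x hx y hy
    apply Subtype.ext
    change (f (x ∔ y) : ℝ) = min 1 ((f x : ℝ) + f y)
    rw [hfV _ (hVo x hx y hy), hfV x (hVS x hx), hfV y (hVS y hy)]
    by_cases h : x ∔ y = one
    · rw [h, g_one, g_odot x y h, min_eq_left]
      linarith [g_nonneg _ (hVm x hx y hy)]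
    · rw [g_oplus x y (hA.odot_eq_zero h), min_eq_right]
      rw [← g_oplus x y (hA.odot_eq_zero h)]
      exact g_le_one _ (hVo x hx y hy)
  · intro x hx
    have h := g_nonneg x (hVS x hx)
    have h' := g_le_one x (hVS x hx)
    apply Subtype.ext
    change (f ∼x : ℝ) = 1 - f x
    rw [hfV x (hVS x hx), hf _ (by rw [g_neg]; linarith) (by rw [g_neg]; linarith), g_neg]
  · apply Subtype.ext
    change (f zero : ℝ) = 0
    rw [hf _ g_zero.ge (by rw [g_zero]; exact zero_le_one), g_zero]
  -- For `x ≤ y` the sum `(y ⊖ x) ⊕ x = y` is untruncated, so `g y - g x = g (y ⊖ x)`, which is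
  -- positive unless `x = y`.
  · have key : ∀ x ∈ S, ∀ y ∈ S, g x = g y → x ≼ y → x = y := by
      intro x hx y hy hxy hle
      have h : (y ∸ x) ⊚ x = zero := by
        rw [MVAlgebra.odot_eq_zero, ← neg_tsub_neg]
        exact tsub_le_self _ _
      have h' := g_oplus _ _ h
      rw [tsub_oplus_cancel hle] at h'
      by_contra hne
      have : y ∸ x ≠ zero := fun h0 => hne (le_antisymm hle (tsub_eq_zero.1 h0))
      linarith [g_pos _ (hVt y hy x hx) this]
    intro x hx y hy hxy
    have hg : g x = g y := by rw [← hfV x (hVS x hx), ← hfV y (hVS y hy), hxy]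
    rcases hA x y with h | h
    · exact key x hx y hy hg h
    · exact (key y hy x hx hg.symm h).symm

/-! ### Ideals and separation by chains -/

section Ideal

variable {A : Type u} [MVAlgebra A]

/-- Ideals: downward closed subsets containing `0` and closed under `⊕`. -/
structure IsIdeal (P : Set A) : Prop where
  zero_mem : zero ∈ P
  oplus_mem : ∀ {x y}, x ∈ P → y ∈ P → x ∔ y ∈ P
  mem_of_le : ∀ {x y}, x ≼ y → y ∈ P → x ∈ P

theorem tsub_le_tsub_oplus_tsub (x y z : A) : x ∸ z ≼ (x ∸ y) ∔ (y ∸ z) := by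
  rw [tsub_le_iff, oplus_comm (x ∸ y), oplus_assoc]
  refine le_trans (le_oplus_tsub x y) (oplus_le_oplus_right ?_ _)
  exact le_oplus_tsub y z

theorem oplus_tsub_oplus_le (x y z w : A) : (x ∔ z) ∸ (y ∔ w) ≼ (x ∸ y) ∔ (z ∸ w) := by
  rw [tsub_le_iff]
  have h : y ∔ w ∔ (x ∸ y ∔ (z ∸ w)) = (y ∔ (x ∸ y)) ∔ (w ∔ (z ∸ w)) := by
    rw [← oplus_assoc, oplus_left_comm w, oplus_assoc]
  rw [h]
  exact le_trans (oplus_le_oplus_right (le_oplus_tsub x y) _)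
    (oplus_le_oplus_left (le_oplus_tsub z w) _)

/-- The congruence of an ideal. -/
def IsIdeal.setoid {P : Set A} (hP : IsIdeal P) : Setoid A where
  r x y := x ∸ y ∈ P ∧ y ∸ x ∈ P
  iseqv :=
    { refl := fun x => by
        rw [tsub_eq_zero.2 (le_refl x)]
        exact ⟨hP.zero_mem, hP.zero_mem⟩
      symm := fun h => ⟨h.2, h.1⟩
      trans := fun {x y z} h h' =>
        ⟨hP.mem_of_le (tsub_le_tsub_oplus_tsub x y z) (hP.oplus_mem h.1 h'.1),
          hP.mem_of_le (tsub_le_tsub_oplus_tsub z y x) (hP.oplus_mem h'.2 h.2)⟩ }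

/-- The quotient of an MV-algebra by an ideal. -/
@[reducible]
def IsIdeal.quotient {P : Set A} (hP : IsIdeal P) : MVAlgebra (Quotient hP.setoid) where
  oplus := Quotient.map₂ oplus fun x x' h y y' h' =>
    ⟨hP.mem_of_le (oplus_tsub_oplus_le x x' y y') (hP.oplus_mem h.1 h'.1),
      hP.mem_of_le (oplus_tsub_oplus_le x' x y' y) (hP.oplus_mem h.2 h'.2)⟩
  neg := Quotient.map neg fun x y h => by
    change _ ∧ _
    rw [neg_tsub_neg, neg_tsub_neg]
    exact ⟨h.2, h.1⟩
  zero := Quotient.mk _ zero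
  oplus_comm := by
    rintro ⟨x⟩ ⟨y⟩
    exact congrArg (Quotient.mk _) (oplus_comm x y)
  oplus_assoc := by
    rintro ⟨x⟩ ⟨y⟩ ⟨z⟩
    exact congrArg (Quotient.mk _) (oplus_assoc x y z)
  oplus_zero := by
    rintro ⟨x⟩
    exact congrArg (Quotient.mk _) (oplus_zero x)
  neg_neg := by
    rintro ⟨x⟩
    exact congrArg (Quotient.mk _) (neg_neg x)
  oplus_one := by
    rintro ⟨x⟩
    exact congrArg (Quotient.mk _) (oplus_one x)
  lukasiewicz := by
    rintro ⟨x⟩ ⟨y⟩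
    exact congrArg (Quotient.mk _) (lukasiewicz x y)

/-- The multiple `u ⊕ ⋯ ⊕ u`. -/
def multiple (u : A) : ℕ → A
  | 0 => zero
  | n + 1 => multiple u n ∔ u

theorem multiple_add (u : A) (m n : ℕ) : multiple u (m + n) = multiple u m ∔ multiple u n := by
  induction n with
  | zero => rw [multiple, oplus_zero, add_zero]
  | succ n ih => rw [← add_assoc, multiple, multiple, ih, oplus_assoc]

/-- The difference `d ⊖ z` lies below both `u` and `v`. -/
theorem le_of_le_oplus_of_disjoint {d z u v : A} (huv : ∀ w, w ≼ u → w ≼ v → w = zero)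
    (hu : d ≼ z ∔ u) (hv : d ≼ z ∔ v) : d ≼ z :=
  tsub_eq_zero.1 (huv _ (tsub_le_iff.2 hu) (tsub_le_iff.2 hv))

theorem le_of_le_oplus_multiple_left {d u v : A} (huv : ∀ w, w ≼ u → w ≼ v → w = zero) (n : ℕ)
    {z : A} (hu : d ≼ z ∔ multiple u n) (hv : d ≼ z ∔ v) : d ≼ z := by
  induction n with
  | zero => rwa [multiple, oplus_zero] at hu
  | succ n ih =>
    refine ih (le_of_le_oplus_of_disjoint huv ?_ (le_trans hv ?_))
    · rwa [multiple, oplus_assoc] at hu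
    · exact oplus_le_oplus_right (le_oplus_right _ _) _

/-- Copies of `v` are removed one at a time, each absorbed into `z` while the disjoint element is
removed by the one-sided version. -/
theorem le_of_le_oplus_multiple {d u v : A} (huv : ∀ w, w ≼ u → w ≼ v → w = zero) (m n : ℕ)
    {z : A} (hu : d ≼ z ∔ multiple u m) (hv : d ≼ z ∔ multiple v n) : d ≼ z := by
  induction n with
  | zero => rwa [multiple, oplus_zero] at hv
  | succ n ih =>
    refine ih (le_of_le_oplus_multiple_left huv m (le_trans hu ?_) ?_)
    · exact oplus_le_oplus_right (le_oplus_right _ _) _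
    · rwa [multiple, oplus_assoc] at hv

/-- The ideal generated by an ideal and an element. -/
theorem IsIdeal.adjoin {P : Set A} (hP : IsIdeal P) (u : A) :
    IsIdeal {x | ∃ p ∈ P, ∃ n, x ≼ p ∔ multiple u n} where
  zero_mem := ⟨zero, hP.zero_mem, 0, zero_le _⟩
  oplus_mem := by
    rintro x y ⟨p, hp, m, hx⟩ ⟨q, hq, n, hy⟩
    refine ⟨p ∔ q, hP.oplus_mem hp hq, m + n, ?_⟩
    have h : p ∔ q ∔ multiple u (m + n) = (p ∔ multiple u m) ∔ (q ∔ multiple u n) := by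
      rw [multiple_add, ← oplus_assoc, oplus_left_comm q, oplus_assoc]
    rw [h]
    exact le_trans (oplus_le_oplus_right hx _) (oplus_le_oplus_left hy _)
  mem_of_le := by
    rintro x y hxy ⟨p, hp, n, hy⟩
    exact ⟨p, hp, n, le_trans hxy hy⟩

/-- A nonzero element is omitted by some prime ideal. -/
theorem exists_prime_ideal {d : A} (hd : d ≠ zero) :
    ∃ P : Set A, IsIdeal P ∧ d ∉ P ∧ ∀ x y, x ∸ y ∈ P ∨ y ∸ x ∈ P := by
  -- An ideal maximal among those omitting `d` works: by maximality, adjoining any further element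
  -- captures `d`.
  obtain ⟨P, hP⟩ : ∃ P, Maximal (· ∈ {P : Set A | IsIdeal P ∧ d ∉ P}) P := by
    obtain ⟨P, -, hP⟩ := zorn_subset_nonempty {P : Set A | IsIdeal P ∧ d ∉ P} (by
      intro c hc hchain hne
      refine ⟨⋃₀ c, ⟨⟨?_, ?_, ?_⟩, ?_⟩, fun s hs => Set.subset_sUnion_of_mem hs⟩
      · obtain ⟨s, hs⟩ := hne
        exact ⟨s, hs, (hc hs).1.zero_mem⟩
      · rintro x y ⟨s, hs, hx⟩ ⟨t, ht, hy⟩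
        rcases hchain.total hs ht with h | h
        · exact ⟨t, ht, (hc ht).1.oplus_mem (h hx) hy⟩
        · exact ⟨s, hs, (hc hs).1.oplus_mem hx (h hy)⟩
      · rintro x y hxy ⟨s, hs, hy⟩
        exact ⟨s, hs, (hc hs).1.mem_of_le hxy hy⟩
      · rintro ⟨s, hs, h⟩
        exact (hc hs).2 h) {zero} ⟨⟨rfl, by rintro _ _ rfl rfl; exact oplus_zero _,
          by rintro x _ h rfl; exact le_zero.1 h⟩, hd⟩
    exact ⟨P, hP⟩
  have hideal : IsIdeal P := hP.prop.1
  have hdP : d ∉ P := hP.prop.2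
  have key : ∀ u, u ∉ P → ∃ p ∈ P, ∃ n, d ≼ p ∔ multiple u n := by
    intro u hu
    by_contra hcon
    refine hu (hP.le_of_ge ⟨hideal.adjoin u, hcon⟩ ?_ ?_)
    · exact fun p hp => ⟨p, hp, 0, le_oplus_right _ _⟩
    · refine ⟨zero, hideal.zero_mem, 1, ?_⟩
      rw [zero_oplus, multiple, multiple, zero_oplus]
      exact le_refl u
  refine ⟨P, hideal, hdP, fun x y => ?_⟩
  -- If neither difference were in `P`, then `d` would lie below `p ⊕ q` plus a multiple of each;
  -- the differences being disjoint, `d ≤ p ⊕ q`, which is in `P`.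
  by_contra! hcon
  obtain ⟨p, hp, m, hm⟩ := key _ hcon.1
  obtain ⟨q, hq, n, hn⟩ := key _ hcon.2
  refine hdP (hideal.mem_of_le (le_of_le_oplus_multiple (z := p ∔ q)
    (fun w => eq_zero_of_le_tsub (x := x) (y := y)) m n (le_trans hm ?_) (le_trans hn ?_))
    (hideal.oplus_mem hp hq))
  · exact oplus_le_oplus_right (le_oplus_right _ _) _
  · rw [oplus_comm p]
    exact oplus_le_oplus_right (le_oplus_right _ _) _

/-- Homomorphisms to MV-chains separate points. -/
theorem exists_chain_separating {a b : A} (hab : a ≠ b) :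
    ∃ (C : Type u) (_ : MVAlgebra C) (q : A → C), IsLinearlyOrdered C ∧ IsHomOn Set.univ q ∧
      q a ≠ q b := by
  obtain ⟨d, hd, hdab⟩ : ∃ d, d ≠ zero ∧ (d = a ∸ b ∨ d = b ∸ a) := by
    by_cases h : a ∸ b = zero
    · refine ⟨b ∸ a, fun h' => hab ?_, Or.inr rfl⟩
      exact le_antisymm (tsub_eq_zero.1 h) (tsub_eq_zero.1 h')
    · exact ⟨_, h, Or.inl rfl⟩
  obtain ⟨P, hP, hdP, hprime⟩ := exists_prime_ideal hd
  let := hP.quotient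
  refine ⟨Quotient hP.setoid, hP.quotient, Quotient.mk _, ?_,
    ⟨fun _ _ _ _ => rfl, fun _ _ => rfl, rfl⟩, ?_⟩
  · have key : ∀ x y : A, x ∸ y ∈ P →
        (Quotient.mk hP.setoid x) ≼ (Quotient.mk hP.setoid y) := by
      intro x y h
      -- The class of `¬x ⊕ y` is `1` because `1 ⊖ (¬x ⊕ y) = x ⊖ y` lies in `P`.
      refine Quotient.sound (s := hP.setoid) (a := ∼x ∔ y) (b := one) ⟨?_, ?_⟩
      · rw [tsub_eq_zero.2 (le_one _)]
        exact hP.zero_mem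
      · rw [tsub, neg_one, zero_oplus]
        exact h
    rintro ⟨x⟩ ⟨y⟩
    exact (hprime x y).imp (key x y) (key y x)
  · intro h
    have h' := Quotient.exact h
    rcases hdab with rfl | rfl
    · exact hdP h'.1
    · exact hdP h'.2

end Ideal

/-! ### Local embeddings of arbitrary MV-algebras, and the theorem -/

/-- Every finite subset of an MV-algebra embeds, as a partial algebra, into a finite power of
`[0,1]`. -/
theorem exists_isHomOn_injOn {A : Type u} [MVAlgebra A] (S : Finset A) :
    ∃ (n : ℕ) (f : A → Fin n → unitInterval), IsHomOn (S : Set A) f ∧ Set.InjOn f S := by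
  classical
  -- One coordinate for each ordered pair of distinct elements of `S`: a chain quotient separating
  -- the pair, followed by a local embedding of the image of `S`.
  have h : ∀ p : S.offDiag, ∃ g : A → unitInterval, IsHomOn (S : Set A) g ∧ g p.1.1 ≠ g p.1.2 := by
    rintro ⟨⟨a, b⟩, hp⟩
    obtain ⟨ha, hb, hab⟩ := Finset.mem_offDiag.1 hp
    obtain ⟨C, _, q, hC, hq, hqab⟩ := exists_chain_separating hab
    have : Nontrivial C := ⟨_, _, hqab⟩
    obtain ⟨g, hg, hinj⟩ := hC.exists_isHomOn_injOn (S.image q)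
    refine ⟨g ∘ q, hg.comp (hq.mono (Set.subset_univ _)) ?_, ?_⟩
    · exact fun x hx => Finset.mem_image_of_mem q hx
    · exact fun h => hqab (hinj (Finset.mem_image_of_mem q ha) (Finset.mem_image_of_mem q hb) h)
  choose g hg hne using h
  let e := Fintype.equivFin S.offDiag
  refine ⟨_, fun a i => g (e.symm i) a, IsHomOn.pi fun i => hg _, ?_⟩
  intro a ha b hb hab
  by_contra h
  refine hne ⟨(a, b), Finset.mem_offDiag.2 ⟨ha, hb, h⟩⟩ ?_
  simpa using congrFun hab (e ⟨(a, b), Finset.mem_offDiag.2 ⟨ha, hb, h⟩⟩)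

end MVAlgebra

open MVAlgebra in
theorem theorem8 (A : Type u) [MVAlgebra A] :
    (Nontrivial A → MVAlgebra.IsLinearlyOrdered A →
      ∃ (I : Type u) (U : Ultrafilter I),
        MVAlgebra.Embeds A (MVAlgebra.Ultrapower U unitInterval)) ∧
    (∃ (K : Type u) (I : K → Type u) (U : ∀ k, Ultrafilter (I k)),
      MVAlgebra.Embeds A (∀ k, MVAlgebra.Ultrapower (U k) unitInterval)) ∧
    (Nontrivial A →
      ∃ (I : Type u) (U : Ultrafilter I),
        MVAlgebra.Embeds A (MVAlgebra.Ultrapower U (ℕ → unitInterval))) ∧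
    (∃ (I : Type u) (U : Ultrafilter I) (n : I → ℕ),
      MVAlgebra.Embeds A (MVAlgebra.Ultraproduct U fun i => Fin (n i) → unitInterval)) := by
  have chain : ∀ (C : Type u) [MVAlgebra C], Nontrivial C → IsLinearlyOrdered C →
      ∃ (I : Type u) (U : Ultrafilter I), Embeds C (Ultrapower U unitInterval) := by
    intro C _ _ hC
    choose f hf hinj using hC.exists_isHomOn_injOn
    exact ⟨Finset C, exists_embeds_ultraproduct _ f hf hinj⟩
  refine ⟨chain A, ?_, fun _ => ?_, ?_⟩
  -- The factors are indexed by pairs of distinct elements, so a one-element algebra gets the empty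
  -- product.
  · have h : ∀ k : {p : A × A // p.1 ≠ p.2}, ∃ (I : Type u) (U : Ultrafilter I)
        (f : A → Ultrapower U unitInterval), IsHomOn Set.univ f ∧ f k.1.1 ≠ f k.1.2 := by
      rintro ⟨⟨a, b⟩, hab⟩
      obtain ⟨C, _, q, hC, hq, hqab⟩ := exists_chain_separating hab
      obtain ⟨I, U, hU⟩ := chain C ⟨_, _, hqab⟩ hC
      obtain ⟨g, hinj, hg⟩ := embeds_iff.1 hU
      exact ⟨I, U, g ∘ q, hg.comp hq (Set.mapsTo_univ _ _), fun h => hqab (hinj h)⟩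
    choose I U f hf hne using h
    refine ⟨_, I, U, embeds_iff.2 ⟨fun a k => f k a, fun a b hab => ?_, IsHomOn.pi hf⟩⟩
    by_contra h
    exact hne ⟨(a, b), h⟩ (congrFun hab _)
  · have h : ∀ S : Finset A, ∃ f : A → ℕ → unitInterval,
        IsHomOn (S : Set A) f ∧ Set.InjOn f S := by
      classical
      intro S
      -- Adding `0` and `1` to `S` forces `n ≠ 0`, since `[0,1]^0` has only one element; this is
      -- where nontriviality enters.
      obtain ⟨n, f, hf, hinj⟩ := exists_isHomOn_injOn (insert zero (insert one S))
      have hn : n ≠ 0 := by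
        rintro rfl
        exact one_ne_zero (hinj (by simp) (by simp) (Subsingleton.elim (f one) (f zero)))
      have hS : (S : Set A) ⊆ (insert zero (insert one S) : Finset A) := by
        intro x hx
        simp only [Finset.coe_insert, Set.mem_insert_iff]
        exact Or.inr (Or.inr hx)
      have : NeZero n := ⟨hn⟩
      -- Repeating the `n` coordinates periodically embeds `[0,1]^n` into the countable power.
      refine ⟨fun a k => f a (Fin.ofNat n k), ⟨?_, ?_, ?_⟩, ?_⟩
      · intro x hx y hy
        simp only [hf.map_oplus x (hS hx) y (hS hy)]
        rfl
      · intro x hx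
        simp only [hf.map_neg x (hS hx)]
        rfl
      · simp only [hf.map_zero]
        rfl
      · intro x hx y hy hxy
        refine hinj (hS hx) (hS hy) (funext fun i => ?_)
        simpa using congrFun hxy i
    choose f hf hinj using h
    exact ⟨Finset A, exists_embeds_ultraproduct _ f hf hinj⟩
  · choose n f hf hinj using exists_isHomOn_injOn (A := A)
    obtain ⟨U, hU⟩ := exists_embeds_ultraproduct _ f hf hinj
    exact ⟨Finset A, U, n, hU⟩
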